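/- **Setting.** A network is a weighted directed graph $\mathrm G$ on nodes $\mathrm V=\{1,\dots,n\}$, $n\ge 1$, given by a real adjacency matrix $A_{\mathrm G}=[a_{ij}]$, where there is an arc from $j$ to $i$ iff $a_{ij}\ne 0$; self-arcs are allowed. Put $\mathrm N_i=\{j: a_{ij}\neq 0\}$ and $\|A_{\mathrm G}\|_\infty=\max_i\sum_{j\in \mathrm N_i}|a_{ij}|$. The node states evolve by $$x_i(t+1)=\sum_{j\in \mathrm N_i}a_{ij}f(x_j(t))+u_i(t)+w_i(t),\qquad t=0,1,2,\dots,$$ where $f:\mathbb R\to\mathbb R$ is unknown and the disturbances satisfy $|w_i(t)|\le w_*$ for an unknown constant $w_*>0$. From time $t+1$ on, node $i$ has an estimate $z_i(t)$ with $|f(x_i(t))-z_i(t)|\le D_0$ for an unknown constant $D_0$. For $L>0$ let $\mathcal F_L$ be the set of all $f:\mathbb R\to\mathbb R$ with $$\lim_{\alpha\to\infty}\ \sup_{x,y\in\mathbb R}\frac{|f(x)-f(y)|}{|x-y|+\alpha}\le L .$$ Let $\overline x(t)=\max_i x_i(t)$ and $\underline x(t)=\min_i x_i(t)$, and let $\overline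 z(t)$, $\underline z(t)$ be the estimates $z_j(t)$ held by a node $j$ that attains the maximum, respectively the minimum (ties broken arbitrarily). A *max-enhanced local-flow/local-decision feedback law* sets $u_i(t)=h^i_t(\cdot)$, where $h^i_t$ is an arbitrary function of: the weights $a_{ij}$, $j\in \mathrm N_i$; for $j\in \mathrm N_i\cup\{i\}$, the values $x_j(s)$ ($s\le t$) and $z_j(s),u_j(s)$ ($s<t$); and $\overline x(s),\underline x(s)$ ($s\le t$), $\overline z(s),\underline z(s)$ ($s<t$). The law *stabilizes* the network if $\sup_{t\ge 0}(|x_i(t)|+|u_i(t)|)<\infty$ for every node $i$, for all initial states, all admissible disturbances and estimates, and all ways of breaking ties. **Theorem.** (i) There is a max-enhanced local-flow/local-decision feedback law, not depending on $n$, $L$ or $\|A_{\mathrm G}\|_\infty$, that for every $L>0$ stabilizes the network for all $f\in\mathcal F_L$ and all graphs $\mathrm G$ (on any number of nodes) with $L<(3/2+\sqrt2)/\|A_{\mathrm G}\|_\infty$, i.e. $L\,\|A_{\mathrm G}\|_\infty<3/2+\sqrt2$. (ii) Let $L>0$ and $\alpha>0$. There is a max-enhanced local-flow/local-decision feedback law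 (which may also depend on $n$, $L$ and $\alpha$) that stabilizes the network for all $f\in\mathcal F_L$ and all graphs $\mathrm G$ (on any number $n\ge1$ of nodes) with $\|A_{\mathrm G}\|_\infty=\alpha$ if and only if $$L<\frac{3/2+\sqrt2}{\alpha}.$$ -/

import Mathlib

open Filter Topology
open scoped ENNReal

noncomputable section

namespace NetworkFeedback

/-- `sup_{x,y} |f x - f y| / (|x - y| + a)`, with values in `[0, ∞]`. -/
def slopeSup (f : ℝ → ℝ) (a : ℝ) : ℝ≥0∞ :=
  ⨆ (x : ℝ) (y : ℝ), ENNReal.ofReal (|f x - f y| / (|x - y| + a))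

/-- The quasi-norm `lim_{a → ∞} sup_{x,y} |f x - f y| / (|x - y| + a)`, with values in `[0, ∞]`.
The limit always exists (see `tendsto_slopeSup`), so that it is the same as the upper limit. -/
def quasiNorm (f : ℝ → ℝ) : ℝ≥0∞ :=
  limsup (slopeSup f) atTop

lemma tendsto_slopeSup (f : ℝ → ℝ) : Tendsto (slopeSup f) atTop (𝓝 (quasiNorm f)) := by
  have hanti : Antitone (fun a : ℝ => slopeSup f (max a 1)) := by
    intro a b hab
    refine iSup_mono fun x => iSup_mono fun y => ENNReal.ofReal_le_ofReal ?_
    have h1 : (0 : ℝ) < max a 1 := lt_of_lt_of_le one_pos (le_max_right _ _)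
    have h2 : max a 1 ≤ max b 1 := max_le_max hab le_rfl
    have h3 := abs_nonneg (x - y)
    exact div_le_div_of_nonneg_left (abs_nonneg _) (by linarith) (by linarith)
  have heq : (fun a : ℝ => slopeSup f (max a 1)) =ᶠ[atTop] slopeSup f := by
    filter_upwards [eventually_ge_atTop (1 : ℝ)] with a ha
    rw [max_eq_left ha]
  have h := (tendsto_atTop_iInf hanti).congr' heq
  have hl : quasiNorm f = _ := h.limsup_eq
  rw [hl]
  exact h

/-- The class `F_L` of all functions `ℝ → ℝ` whose quasi-norm is at most `L`. -/
def FClass (L : ℝ) : Set (ℝ → ℝ) :=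
  {f | quasiNorm f ≤ ENNReal.ofReal L}

/-- The neighbours of node `i`: the nodes `j` with an arc from `j` to `i`. The weighted directed
graph is given by its adjacency matrix `A`; there is an arc `(j, i)` iff `A i j ≠ 0`. -/
def nbrs {n : ℕ} (A : Matrix (Fin n) (Fin n) ℝ) (i : Fin n) : Finset (Fin n) :=
  {j | A i j ≠ 0}

/-- The infinity norm `max_i ∑_{j ∈ N_i} |a_ij|` of the adjacency matrix. -/
def infNorm {n : ℕ} (A : Matrix (Fin n) (Fin n) ℝ) : ℝ :=
  ⨆ i : Fin n, ∑ j ∈ nbrs A i, |A i j|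

/-- What a node can use at a time `t`: the weights of its incoming arcs, the local flow vector
and the extreme states of the network with their `z`-values. Node labels and times are natural
numbers; entries that the node does not have are `0`. -/
structure LocalInfo where
  /-- weights `a_ij` of the arcs coming in from the neighbours `j` -/
  weight : ℕ → ℝ
  /-- states `x_j(s)` -/
  x : ℕ → ℕ → ℝ
  /-- estimates `z_j(s)` of `f(x_j(s))` -/
  z : ℕ → ℕ → ℝ
  /-- inputs `u_j(s)` -/
  u : ℕ → ℕ → ℝ
  /-- maximal state at time `s` -/
  xMax : ℕ → ℝ
  /-- minimal state at time `s` -/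
  xMin : ℕ → ℝ
  /-- estimate held by a node of maximal state at time `s` -/
  zMax : ℕ → ℝ
  /-- estimate held by a node of minimal state at time `s` -/
  zMin : ℕ → ℝ

/-- A max-consensus-enhanced local-flow/local-decision feedback law: for every node label `i` and
time `t` an arbitrary function of what node `i` knows at time `t`. -/
def FeedbackLaw : Type := ℕ → ℕ → LocalInfo → ℝ

/-- The information of node `i` at time `t`: the weights `a_ij` for `j ∈ N_i`; for
`j ∈ N_i ∪ {i}` the `x_j(s)`, `s ≤ t`, and the `z_j(s)`, `u_j(s)`, `s < t`; the extreme states at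
times `s ≤ t` and their `z`-values at times `s < t`. Here `jMax s` and `jMin s` are the nodes that
are selected as the nodes of maximal and minimal state at time `s`. -/
def localInfo {n : ℕ} (A : Matrix (Fin n) (Fin n) ℝ) (x z u : ℕ → Fin n → ℝ)
    (jMax jMin : ℕ → Fin n) (i : Fin n) (t : ℕ) : LocalInfo where
  weight j := if h : j < n then (if ⟨j, h⟩ ∈ nbrs A i then A i ⟨j, h⟩ else 0) else 0
  x j s := if h : j < n then
    (if ⟨j, h⟩ ∈ insert i (nbrs A i) ∧ s ≤ t then x s ⟨j, h⟩ else 0) else 0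
  z j s := if h : j < n then
    (if ⟨j, h⟩ ∈ insert i (nbrs A i) ∧ s < t then z s ⟨j, h⟩ else 0) else 0
  u j s := if h : j < n then
    (if ⟨j, h⟩ ∈ insert i (nbrs A i) ∧ s < t then u s ⟨j, h⟩ else 0) else 0
  xMax s := if s ≤ t then x s (jMax s) else 0
  xMin s := if s ≤ t then x s (jMin s) else 0
  zMax s := if s < t then z s (jMax s) else 0
  zMin s := if s < t then z s (jMin s) else 0

/-- `(x, z, u, w)` is a run of the network with adjacency matrix `A` and node dynamics `f` in closed
loop with the feedback law `h`, for an admissible disturbance `w` and admissible estimates `z`.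
(`x t i` is the state of node `i` at time `t`.) -/
structure IsClosedLoop (h : FeedbackLaw) {n : ℕ} (A : Matrix (Fin n) (Fin n) ℝ) (f : ℝ → ℝ)
    (x z u w : ℕ → Fin n → ℝ) (jMax jMin : ℕ → Fin n) : Prop where
  dynamics : ∀ t i, x (t + 1) i = ∑ j ∈ nbrs A i, A i j * f (x t j) + u t i + w t i
  control : ∀ t (i : Fin n), u t i = h (i : ℕ) t (localInfo A x z u jMax jMin i t)
  disturbance_bounded : ∃ wStar > 0, ∀ t i, |w t i| ≤ wStar
  estimate_bounded : ∃ D₀, ∀ t i, |f (x t i) - z t i| ≤ D₀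
  isMax : ∀ t i, x t i ≤ x t (jMax t)
  isMin : ∀ t i, x t (jMin t) ≤ x t i

/-- The law `h` stabilizes the network with adjacency matrix `A` and node dynamics `f`: for all
initial states, all bounded disturbances, all estimates with bounded error (the bounds being unknown
to the law), and however ties between extreme nodes are broken, all states and inputs of the closed
loop stay bounded. -/
def Stabilizes (h : FeedbackLaw) {n : ℕ} (A : Matrix (Fin n) (Fin n) ℝ) (f : ℝ → ℝ) : Prop :=
  ∀ (x z u w : ℕ → Fin n → ℝ) (jMax jMin : ℕ → Fin n),
    IsClosedLoop h A f x z u w jMax jMin →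
      ∀ i, BddAbove (Set.range fun t => |x t i| + |u t i|)

end NetworkFeedback

end

noncomputable section

namespace NetworkFeedback

/-! ### Functions of finite quasi-norm -/

lemma exists_abs_sub_le_of_mem_FClass {f : ℝ → ℝ} {L L' : ℝ} (hL : 0 ≤ L) (hLL' : L < L')
    (hf : f ∈ FClass L) : ∃ a > 0, ∀ x y, |f x - f y| ≤ L' * (|x - y| + a) := by
  have hlt : quasiNorm f < ENNReal.ofReal L' :=
    lt_of_le_of_lt hf ((ENNReal.ofReal_lt_ofReal_iff (hL.trans_lt hLL')).2 hLL')
  obtain ⟨a, ha, ha0⟩ :=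
    (((tendsto_slopeSup f).eventually_lt_const hlt).and (eventually_gt_atTop 0)).exists
  refine ⟨a, ha0, fun x y => ?_⟩
  have h1 : ENNReal.ofReal (|f x - f y| / (|x - y| + a)) ≤ ENNReal.ofReal L' :=
    (le_iSup₂ (f := fun x y : ℝ => ENNReal.ofReal (|f x - f y| / (|x - y| + a))) x y).trans ha.le
  have h2 := (ENNReal.ofReal_le_ofReal_iff (hL.trans hLL'.le)).1 h1
  have h3 : 0 < |x - y| + a := by positivity
  rwa [div_le_iff₀ h3] at h2

lemma mem_FClass_of_lipschitz {f : ℝ → ℝ} {L : ℝ} (hL : 0 ≤ L)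
    (hf : ∀ x y, |f x - f y| ≤ L * |x - y|) : f ∈ FClass L := by
  refine le_of_tendsto (tendsto_slopeSup f) ?_
  filter_upwards [eventually_gt_atTop 0] with a ha
  refine iSup₂_le fun x y => ENNReal.ofReal_le_ofReal ?_
  have h3 : 0 < |x - y| + a := by positivity
  rw [div_le_iff₀ h3]
  nlinarith [hf x y]

/-! ### Adjacency matrices -/

lemma sum_abs_le_infNorm {n : ℕ} (A : Matrix (Fin n) (Fin n) ℝ) (i : Fin n) :
    ∑ j ∈ nbrs A i, |A i j| ≤ infNorm A :=
  le_ciSup (f := fun i : Fin n => ∑ j ∈ nbrs A i, |A i j|) (Set.finite_range _).bddAbove i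

lemma infNorm_nonneg {n : ℕ} (A : Matrix (Fin n) (Fin n) ℝ) : 0 ≤ infNorm A :=
  Real.iSup_nonneg fun _ => Finset.sum_nonneg fun _ _ => abs_nonneg _

/-! ### Growth of the running hull below the critical value -/

/-- If every increase of the largest extension `M` of a hull of length `D` obeys
`M' ≤ K M + c - D / 2` with `K` below the critical value, then `M` is bounded. -/
lemma bddAbove_extension {K c : ℝ} {D M : ℕ → ℝ} (hK1 : 1 ≤ K) (hK : K < 3 / 2 + √2)
    (hc : 0 ≤ c) (hM : Monotone M) (hD : Monotone D) (hD0 : 0 ≤ D 0)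
    (hstep : ∀ t, M (t + 1) = M t ∨
      (M (t + 1) ≤ K * M t + c - D t / 2 ∧ D t + M (t + 1) ≤ D (t + 1))) :
    ∃ C, ∀ t, M t ≤ C := by
  by_contra! hunb
  obtain ⟨K', hKK', hK'⟩ := exists_between hK
  obtain ⟨t₀, ht₀⟩ := hunb (c / (K' - K))
  have hε : 0 < K' - K := by linarith
  have hM0 : ∀ t, t₀ ≤ t → 0 < M t ∧ c ≤ (K' - K) * M t := by
    intro t ht
    have h1 : c / (K' - K) < M t := ht₀.trans_le (hM ht)
    refine ⟨lt_of_le_of_lt (by positivity) h1, ?_⟩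
    rw [div_lt_iff₀ hε] at h1
    linarith
  have hs : √2 * √2 = 2 := Real.mul_self_sqrt (by norm_num)
  have hs0 : 1 ≤ √2 := Real.one_le_sqrt.2 (by norm_num)
  have hK'0 : 0 < K' := by linarith
  have hpos : 0 < K' - (K' - 1 / 2) ^ 2 / 2 := by
    have : 0 < (3 / 2 + √2 - K') * (K' - (3 / 2 - √2)) :=
      mul_pos (by linarith) (by linarith)
    nlinarith
  obtain ⟨δ, hδ0, hδ⟩ : ∃ δ > 0, δ * K' = K' - (K' - 1 / 2) ^ 2 / 2 :=
    ⟨(K' - (K' - 1 / 2) ^ 2 / 2) / K', by positivity, by field_simp⟩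
  have hDnn : ∀ t, 0 ≤ D t := fun t => hD0.trans (hD (Nat.zero_le t))
  have hrec : ∀ t, t₀ ≤ t → ∃ t', t ≤ t' ∧ M t' = M t ∧ M t < M (t' + 1) := by
    intro t ht
    have hex : ∃ k, M t < M (t + k) := by
      obtain ⟨s, hs⟩ := hunb (M t)
      exact ⟨s, hs.trans_le (hM (by omega))⟩
    classical
    obtain ⟨k, hk, hmin⟩ : ∃ k, M t < M (t + k) ∧ ∀ l < k, ¬ M t < M (t + l) :=
      ⟨Nat.find hex, Nat.find_spec hex, fun l hl => Nat.find_min hex hl⟩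
    cases k with
    | zero => simp at hk
    | succ k =>
      exact ⟨t + k, by omega, le_antisymm (not_lt.1 (hmin k (by omega))) (hM (by omega)), hk⟩
  have hrecord : ∀ t, t₀ ≤ t → M t < M (t + 1) →
      M (t + 1) ≤ K' * M t - D t / 2 ∧ D t + M (t + 1) ≤ D (t + 1) := by
    intro t ht hlt
    rcases hstep t with h | h
    · linarith
    · exact ⟨by nlinarith [(hM0 t ht).2], h.2⟩
  have hratio : ∀ k : ℕ, ∃ t, t₀ ≤ t ∧ k * δ * M t ≤ D t := by
    intro k
    induction k with
    | zero => exact ⟨t₀, le_rfl, by simpa using hDnn t₀⟩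
    | succ k ih =>
      obtain ⟨t, ht, hk⟩ := ih
      obtain ⟨t', htt', hMt', hlt⟩ := hrec t ht
      have ht' := ht.trans htt'
      rw [← hMt'] at hlt hk
      have hk' := hk.trans (hD htt')
      obtain ⟨h1, h2⟩ := hrecord t' ht' hlt
      refine ⟨t' + 1, by omega, le_trans ?_ h2⟩
      have hm := (hM0 t' ht').1
      obtain ⟨p, hp⟩ : ∃ p, D t' = p * M t' := ⟨D t' / M t', by field_simp⟩
      have hp0 : 0 ≤ p := by
        have := hDnn t'
        rw [hp] at this
        exact nonneg_of_mul_nonneg_left this hm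
      have hkp : k * δ ≤ p := by
        rw [hp] at hk'
        exact le_of_mul_le_mul_right hk' hm
      rw [hp] at h1 ⊢
      have hm' : 0 < M (t' + 1) := hm.trans hlt
      have hle : (k + 1) * δ * M (t' + 1) ≤ (p + δ) * M (t' + 1) :=
        mul_le_mul_of_nonneg_right (by linarith) hm'.le
      push_cast
      refine hle.trans ?_
      suffices (p + δ - 1) * M (t' + 1) ≤ p * M t' by linarith
      rcases le_total (p + δ) 1 with hp1 | hp1
      · exact (mul_nonpos_of_nonpos_of_nonneg (by linarith) hm'.le).trans (by positivity)
      · calc (p + δ - 1) * M (t' + 1) ≤ (p + δ - 1) * ((K' - p / 2) * M t') :=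
              mul_le_mul_of_nonneg_left (by linarith) (by linarith)
          _ = ((p + δ - 1) * (K' - p / 2)) * M t' := by ring
          _ ≤ p * M t' := mul_le_mul_of_nonneg_right
              (by nlinarith [sq_nonneg (p - (K' - 1 / 2)), mul_nonneg hδ0.le hp0]) hm.le
  obtain ⟨k, hk⟩ := exists_nat_gt (2 * K' / δ)
  obtain ⟨t, ht, hkt⟩ := hratio k
  obtain ⟨t', htt', hMt', hlt⟩ := hrec t ht
  have ht' := ht.trans htt'
  rw [← hMt'] at hkt hlt
  have hkt' := hkt.trans (hD htt')
  obtain ⟨h1, -⟩ := hrecord t' ht' hlt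
  rw [div_lt_iff₀ hδ0] at hk
  have hm := (hM0 t' ht').1
  nlinarith [mul_lt_mul_of_pos_right hk hm]

/-- The largest one-sided extension of the hull `[b, B]` up to time `t`, the initial hull
included. -/
def maxExtension (b B : ℕ → ℝ) : ℕ → ℝ
  | 0 => B 0 - b 0
  | t + 1 => max (maxExtension b B t) (max (B (t + 1) - B t) (b t - b (t + 1)))

lemma maxExtension_mono (b B : ℕ → ℝ) : Monotone (maxExtension b B) :=
  monotone_nat_of_le_succ fun _ => le_max_left _ _

lemma bddAbove_hull {K c : ℝ} {b B : ℕ → ℝ} (hK1 : 1 ≤ K) (hK : K < 3 / 2 + √2) (hc : 0 ≤ c)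
    (hb : Antitone b) (hB : Monotone B) (h0 : b 0 ≤ B 0)
    (hBstep : ∀ t, B (t + 2) ≤
      max (B (t + 1)) ((b (t + 1) + B (t + 1)) / 2 + (K * maxExtension b B (t + 1) + c)))
    (hbstep : ∀ t,
      min (b (t + 1)) ((b (t + 1) + B (t + 1)) / 2 - (K * maxExtension b B (t + 1) + c)) ≤
        b (t + 2)) :
    ∃ C, ∀ t, B t - b t ≤ C := by
  have hD : Monotone fun t => B t - b t := fun s t hst => by
    have h1 := hb hst
    have h2 := hB hst
    simp only
    linarith
  obtain ⟨C, hC⟩ := bddAbove_extension (D := fun t => B (t + 1) - b (t + 1))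
    (M := fun t => maxExtension b B (t + 1)) hK1 hK hc
    (fun s t hst => maxExtension_mono b B (by omega)) (fun s t hst => hD (by omega))
    (by have := hD (Nat.zero_le 1); simp only at this ⊢; linarith) (by
      intro t
      have h1 : maxExtension b B (t + 1 + 1) = max (maxExtension b B (t + 1))
        (max (B (t + 1 + 1) - B (t + 1)) (b (t + 1) - b (t + 1 + 1))) := rfl
      have h2 := hBstep t
      have h3 := hbstep t
      have h4 := hB (Nat.le_succ (t + 1))
      have h5 := hb (Nat.le_succ (t + 1))
      simp only [Nat.succ_eq_add_one] at h4 h5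
      rw [show t + 1 + 1 = t + 2 from rfl] at *
      rcases le_or_gt (max (B (t + 2) - B (t + 1)) (b (t + 1) - b (t + 2)))
        (maxExtension b B (t + 1)) with h | h
      · left
        rw [h1, max_eq_left h]
      · right
        rw [h1, max_eq_right h.le]
        have hpos : 0 < max (B (t + 2) - B (t + 1)) (b (t + 1) - b (t + 2)) := by
          have h6 := maxExtension_mono b B (Nat.zero_le (t + 1))
          have h7 : maxExtension b B 0 = B 0 - b 0 := rfl
          linarith
        rcases max_choice (B (t + 2) - B (t + 1)) (b (t + 1) - b (t + 2)) with h6 | h6 <;>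
          rw [h6] at hpos ⊢ <;> constructor
        · rcases le_max_iff.1 h2 with h7 | h7 <;> linarith
        · linarith
        · rcases min_le_iff.1 h3 with h7 | h7 <;> linarith
        · linarith)
  have hC' : ∀ t, maxExtension b B t ≤ C := fun t =>
    (maxExtension_mono b B (Nat.le_succ t)).trans (hC t)
  refine ⟨max (B 1 - b 1) (2 * (K * C + c)), fun t => (hD (Nat.le_succ t)).trans ?_⟩
  simp only [Nat.succ_eq_add_one]
  induction t with
  | zero => exact le_max_left _ _
  | succ t ih =>
    have h2 := hBstep t
    have h3 := hbstep t
    have h8 : K * maxExtension b B (t + 1) ≤ K * C :=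
      mul_le_mul_of_nonneg_left (hC' _) (by linarith)
    rw [show t + 1 + 1 = t + 2 from rfl]
    rcases le_max_iff.1 h2 with h7 | h7 <;> rcases min_le_iff.1 h3 with h6 | h6 <;>
      rcases le_max_iff.1 ih with h9 | h9 <;> rw [le_max_iff] <;>
      first
        | (left; linarith)
        | (right; linarith)
        | (rcases le_total (B (t + 2) - b (t + 2)) (B (t + 1) - b (t + 1)) with h10 | h10
           · left; linarith
           · right; linarith)

/-! ### The nearest-extreme feedback law -/

/-- `z` is the estimate held at an extreme state of some time before `t` which is nearest to `y`
among all these extreme states. -/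
def IsNearestEstimate (I : LocalInfo) (t : ℕ) (y z : ℝ) : Prop :=
  ∃ P : ℝ, (∃ s < t, (P = I.xMax s ∧ z = I.zMax s) ∨ (P = I.xMin s ∧ z = I.zMin s)) ∧
    ∀ s < t, |y - P| ≤ |y - I.xMax s| ∧ |y - P| ≤ |y - I.xMin s|

/-- An estimate held at a nearest extreme state of the past. -/
def nearestEstimate (I : LocalInfo) (t : ℕ) (y : ℝ) : ℝ :=
  Classical.epsilon (IsNearestEstimate I t y)

lemma exists_isNearestEstimate (I : LocalInfo) (t : ℕ) (y : ℝ) :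
    ∃ z, IsNearestEstimate I (t + 1) y z := by
  obtain ⟨⟨s, e⟩, -, hs⟩ := Finset.exists_min_image
    (Finset.univ : Finset (Fin (t + 1) × Bool))
    (fun p => |y - if p.2 then I.xMax p.1 else I.xMin p.1|) Finset.univ_nonempty
  refine ⟨if e then I.zMax s else I.zMin s, if e then I.xMax s else I.xMin s,
    ⟨s, s.2, by cases e <;> simp⟩, fun r hr => ⟨?_, ?_⟩⟩
  · simpa using hs (⟨r, hr⟩, true) (Finset.mem_univ _)
  · simpa using hs (⟨r, hr⟩, false) (Finset.mem_univ _)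

lemma isNearestEstimate_nearestEstimate (I : LocalInfo) (t : ℕ) (y : ℝ) :
    IsNearestEstimate I (t + 1) y (nearestEstimate I (t + 1) y) :=
  Classical.epsilon_spec (exists_isNearestEstimate I t y)

/-- The running minimum of a sequence. -/
def runMin (x : ℕ → ℝ) : ℕ → ℝ
  | 0 => x 0
  | t + 1 => min (runMin x t) (x (t + 1))

/-- The running maximum of a sequence. -/
def runMax (x : ℕ → ℝ) : ℕ → ℝ
  | 0 => x 0
  | t + 1 => max (runMax x t) (x (t + 1))

lemma runMin_congr {x y : ℕ → ℝ} {t : ℕ} (h : ∀ s ≤ t, x s = y s) : runMin x t = runMin y t := by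
  induction t with
  | zero => exact h 0 le_rfl
  | succ t ih => rw [runMin, runMin, ih fun s hs => h s (by omega), h _ le_rfl]

lemma runMax_congr {x y : ℕ → ℝ} {t : ℕ} (h : ∀ s ≤ t, x s = y s) : runMax x t = runMax y t := by
  induction t with
  | zero => exact h 0 le_rfl
  | succ t ih => rw [runMax, runMax, ih fun s hs => h s (by omega), h _ le_rfl]

lemma runMin_antitone (x : ℕ → ℝ) : Antitone (runMin x) :=
  antitone_nat_of_succ_le fun _ => min_le_left _ _

lemma runMax_mono (x : ℕ → ℝ) : Monotone (runMax x) :=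
  monotone_nat_of_le_succ fun _ => le_max_left _ _

lemma runMin_le (x : ℕ → ℝ) (t : ℕ) : runMin x t ≤ x t := by
  cases t with
  | zero => exact le_rfl
  | succ t => exact min_le_right _ _

lemma le_runMax (x : ℕ → ℝ) (t : ℕ) : x t ≤ runMax x t := by
  cases t with
  | zero => exact le_rfl
  | succ t => exact le_max_right _ _

lemma exists_runMin_eq (x : ℕ → ℝ) (t : ℕ) : ∃ s ≤ t, runMin x t = x s := by
  induction t with
  | zero => exact ⟨0, le_rfl, rfl⟩
  | succ t ih =>
    obtain ⟨s, hs, h⟩ := ih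
    rcases min_choice (runMin x t) (x (t + 1)) with h1 | h1
    · exact ⟨s, by omega, h1.trans h⟩
    · exact ⟨t + 1, le_rfl, h1⟩

lemma exists_runMax_eq (x : ℕ → ℝ) (t : ℕ) : ∃ s ≤ t, runMax x t = x s := by
  induction t with
  | zero => exact ⟨0, le_rfl, rfl⟩
  | succ t ih =>
    obtain ⟨s, hs, h⟩ := ih
    rcases max_choice (runMax x t) (x (t + 1)) with h1 | h1
    · exact ⟨s, by omega, h1.trans h⟩
    · exact ⟨t + 1, le_rfl, h1⟩

/-- Every point of the running hull is close to an extreme point of the past. -/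
lemma exists_near_extreme (p q : ℕ → ℝ) (t : ℕ) {y : ℝ}
    (hy : y ∈ Set.Icc (runMin p (t + 1)) (runMax q (t + 1))) :
    ∃ s ≤ t, |y - q s| ≤ maxExtension (runMin p) (runMax q) (t + 1) ∨
      |y - p s| ≤ maxExtension (runMin p) (runMax q) (t + 1) := by
  induction t with
  | zero =>
    have hM : maxExtension (runMin p) (runMax q) 1 = max (runMax q 0 - runMin p 0)
      (max (runMax q 1 - runMax q 0) (runMin p 0 - runMin p 1)) := rfl
    obtain ⟨h1, h2⟩ := hy
    have e1 : runMax q 0 = q 0 := rfl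
    have e2 : runMin p 0 = p 0 := rfl
    rw [e1, e2] at hM
    simp only [zero_add] at *
    refine ⟨0, le_rfl, ?_⟩
    rw [hM, le_max_iff, le_max_iff, le_max_iff, le_max_iff]
    rcases le_total y (q 0) with h3 | h3
    · rcases le_total y (p 0) with h4 | h4
      · right; right; right
        rw [abs_of_nonpos (by linarith)]; linarith
      · right; left
        rw [abs_of_nonneg (by linarith)]; linarith
    · left; right; left
      rw [abs_of_nonneg (by linarith)]; linarith
  | succ t ih =>
    have hM : maxExtension (runMin p) (runMax q) (t + 1 + 1) =
      max (maxExtension (runMin p) (runMax q) (t + 1))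
      (max (runMax q (t + 1 + 1) - runMax q (t + 1))
        (runMin p (t + 1) - runMin p (t + 1 + 1))) := rfl
    obtain ⟨h1, h2⟩ := hy
    rcases le_or_gt y (runMax q (t + 1)) with h3 | h3
    · rcases le_or_gt (runMin p (t + 1)) y with h4 | h4
      · obtain ⟨s, hs, h⟩ := ih ⟨h4, h3⟩
        have hmono := maxExtension_mono (runMin p) (runMax q) (Nat.le_succ (t + 1))
        exact ⟨s, by omega, h.imp (·.trans hmono) (·.trans hmono)⟩
      · obtain ⟨s, hs, h⟩ := exists_runMin_eq p (t + 1)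
        refine ⟨s, hs, Or.inr ?_⟩
        rw [hM, ← h, abs_of_nonpos (by linarith)]
        exact le_max_of_le_right (le_max_of_le_right (by linarith))
    · obtain ⟨s, hs, h⟩ := exists_runMax_eq q (t + 1)
      refine ⟨s, hs, Or.inl ?_⟩
      rw [hM, ← h, abs_of_nonneg (by linarith)]
      exact le_max_of_le_right (le_max_of_le_left (by linarith))

/-- Predict every `f (x_j t)` by the estimate held at the nearest extreme state of the past, cancel
the predicted flow, and steer to the midpoint of the hull of all past states. -/
def nearestExtremeLaw : FeedbackLaw := fun _ t I =>
  (runMin I.xMin t + runMax I.xMax t) / 2 - ∑ᶠ j, I.weight j * nearestEstimate I t (I.x j t)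

lemma finsum_weight_mul {n : ℕ} (A : Matrix (Fin n) (Fin n) ℝ) (x z u : ℕ → Fin n → ℝ)
    (jMax jMin : ℕ → Fin n) (i : Fin n) (t : ℕ) (g : ℝ → ℝ) :
    ∑ᶠ j, (localInfo A x z u jMax jMin i t).weight j * g ((localInfo A x z u jMax jMin i t).x j t) =
      ∑ j ∈ nbrs A i, A i j * g (x t j) := by
  rw [finsum_eq_sum_of_support_subset (s := Finset.range n), Finset.sum_range]
  · rw [← Finset.sum_subset (Finset.subset_univ (nbrs A i))]
    · refine Finset.sum_congr rfl fun j hj => ?_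
      simp [localInfo, hj]
    · intro j _ hj
      simp [localInfo, hj]
  · intro j hj
    by_contra h
    refine hj ?_
    have : ¬ j < n := by simpa using h
    simp [localInfo, this]

theorem stabilizes_nearestExtremeLaw {L : ℝ} (hL : 0 < L) {n : ℕ}
    (A : Matrix (Fin n) (Fin n) ℝ) (hLA : L * infNorm A < 3 / 2 + √2) {f : ℝ → ℝ}
    (hf : f ∈ FClass L) : Stabilizes nearestExtremeLaw A f := by
  intro x z u w jMax jMin hcl i₀
  have hα := infNorm_nonneg A
  obtain ⟨L', hLL', hL'A⟩ : ∃ L', L < L' ∧ L' * infNorm A < 3 / 2 + √2 := by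
    have hcont : ContinuousWithinAt (fun l => l * infNorm A) (Set.Ioi L) L := by fun_prop
    obtain ⟨l, h1, h2⟩ :=
      ((hcont.eventually_lt_const hLA).and self_mem_nhdsWithin).exists
    exact ⟨l, h2, h1⟩
  obtain ⟨a, ha, hfa⟩ := exists_abs_sub_le_of_mem_FClass hL.le hLL' hf
  have hL' : 0 < L' := hL.trans hLL'
  obtain ⟨W, hW0, hW⟩ := hcl.disturbance_bounded
  obtain ⟨E, hE⟩ := hcl.estimate_bounded
  have hE0 : 0 ≤ E := (abs_nonneg _).trans (hE 0 i₀)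
  set p : ℕ → ℝ := fun s => x s (jMin s) with hp
  set q : ℕ → ℝ := fun s => x s (jMax s) with hq
  have hmin : ∀ t i, runMin p t ≤ x t i := fun t i => (runMin_le p t).trans (hcl.isMin t i)
  have hmax : ∀ t i, x t i ≤ runMax q t := fun t i => (hcl.isMax t i).trans (le_runMax q t)
  set K := max 1 (L' * infNorm A) with hK
  have hK1 : 1 ≤ K := le_max_left _ _
  have hKc : K < 3 / 2 + √2 := max_lt (by linarith [Real.sqrt_nonneg 2]) hL'A
  set c := infNorm A * (L' * a + E) + W with hc
  have hc0 : 0 ≤ c := by positivity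
  set M := maxExtension (runMin p) (runMax q) with hMdef
  have hM0 : ∀ t, 0 ≤ M t := fun t => by
    refine le_trans ?_ (maxExtension_mono (runMin p) (runMax q) (Nat.zero_le t))
    have h1 := hmin 0 i₀
    have h2 := hmax 0 i₀
    change 0 ≤ runMax q 0 - runMin p 0
    linarith
  have hpred : ∀ t i j, |f (x (t + 1) j) -
      nearestEstimate (localInfo A x z u jMax jMin i (t + 1)) (t + 1) (x (t + 1) j)| ≤
        L' * M (t + 1) + (L' * a + E) := by
    intro t i j
    set I := localInfo A x z u jMax jMin i (t + 1) with hI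
    have hIq : ∀ s < t + 1, I.xMax s = x s (jMax s) := fun s hs => if_pos hs.le
    have hIp : ∀ s < t + 1, I.xMin s = x s (jMin s) := fun s hs => if_pos hs.le
    have hIzq : ∀ s < t + 1, I.zMax s = z s (jMax s) := fun s hs => if_pos hs
    have hIzp : ∀ s < t + 1, I.zMin s = z s (jMin s) := fun s hs => if_pos hs
    obtain ⟨P, ⟨s, hs, hP⟩, hnear⟩ := isNearestEstimate_nearestEstimate I t (x (t + 1) j)
    have hdist : |x (t + 1) j - P| ≤ M (t + 1) := by
      obtain ⟨r, hr, h⟩ := exists_near_extreme p q t ⟨hmin (t + 1) j, hmax (t + 1) j⟩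
      have hr' : r < t + 1 := by omega
      have h1 := hnear r hr'
      rw [hIq r hr', hIp r hr'] at h1
      exact h.elim h1.1.trans h1.2.trans
    have hz : |f P - nearestEstimate I (t + 1) (x (t + 1) j)| ≤ E := by
      rcases hP with ⟨h1, h2⟩ | ⟨h1, h2⟩
      · rw [h2, h1, hIq s hs, hIzq s hs]; exact hE _ _
      · rw [h2, h1, hIp s hs, hIzp s hs]; exact hE _ _
    have h1 := hfa (x (t + 1) j) P
    have h2 := mul_le_mul_of_nonneg_left hdist hL'.le
    refine (abs_sub_le _ (f P) _).trans ?_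
    linarith
  have hdyn : ∀ t i, |x (t + 2) i - (runMin p (t + 1) + runMax q (t + 1)) / 2| ≤
      K * M (t + 1) + c := by
    intro t i
    set I := localInfo A x z u jMax jMin i (t + 1) with hI
    have hmn : runMin I.xMin (t + 1) = runMin p (t + 1) := runMin_congr fun s hs => if_pos hs
    have hmx : runMax I.xMax (t + 1) = runMax q (t + 1) := runMax_congr fun s hs => if_pos hs
    have hu : u (t + 1) i = (runMin p (t + 1) + runMax q (t + 1)) / 2 -
        ∑ j ∈ nbrs A i, A i j * nearestEstimate I (t + 1) (x (t + 1) j) := by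
      rw [hcl.control (t + 1) i, nearestExtremeLaw, ← hI, hmn, hmx, hI, finsum_weight_mul]
    rw [hcl.dynamics (t + 1) i, hu]
    have hsum : |∑ j ∈ nbrs A i, A i j *
        (f (x (t + 1) j) - nearestEstimate I (t + 1) (x (t + 1) j))| ≤
        infNorm A * (L' * M (t + 1) + (L' * a + E)) := by
      refine (Finset.abs_sum_le_sum_abs _ _).trans ?_
      have h0 : 0 ≤ L' * M (t + 1) + (L' * a + E) := by
        have := hM0 (t + 1)
        positivity
      refine le_trans ?_ (mul_le_mul_of_nonneg_right (sum_abs_le_infNorm A i) h0)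
      rw [Finset.sum_mul]
      refine Finset.sum_le_sum fun j _ => ?_
      rw [abs_mul]
      exact mul_le_mul_of_nonneg_left (hpred t i j) (abs_nonneg _)
    have hKM : L' * infNorm A * M (t + 1) ≤ K * M (t + 1) :=
      mul_le_mul_of_nonneg_right (le_max_right _ _) (hM0 _)
    have heq : ∑ j ∈ nbrs A i, A i j * f (x (t + 1) j) +
        ((runMin p (t + 1) + runMax q (t + 1)) / 2 -
          ∑ j ∈ nbrs A i, A i j * nearestEstimate I (t + 1) (x (t + 1) j)) + w (t + 1) i -
        (runMin p (t + 1) + runMax q (t + 1)) / 2 =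
        ∑ j ∈ nbrs A i, A i j *
          (f (x (t + 1) j) - nearestEstimate I (t + 1) (x (t + 1) j)) + w (t + 1) i := by
      simp only [mul_sub, Finset.sum_sub_distrib]
      ring
    rw [heq]
    refine (abs_add_le _ _).trans ?_
    have := hW (t + 1) i
    linarith
  obtain ⟨C, hC⟩ := bddAbove_hull hK1 hKc hc0 (runMin_antitone p) (runMax_mono q)
    ((hmin 0 i₀).trans (hmax 0 i₀))
    (fun t => max_le_max le_rfl (by
      have := (abs_le.1 (hdyn t (jMax (t + 2)))).2
      change x (t + 2) (jMax (t + 2)) ≤ _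
      linarith))
    (fun t => min_le_min le_rfl (by
      have := (abs_le.1 (hdyn t (jMin (t + 2)))).1
      change _ ≤ x (t + 2) (jMin (t + 2))
      linarith))
  have hx : ∀ t i, |x t i| ≤ |x 0 i₀| + C := by
    intro t i
    have h1 := hmin t i
    have h2 := hmax t i
    have h3 := (runMin_antitone p (Nat.zero_le t)).trans (hmin 0 i₀)
    have h4 := (hmax 0 i₀).trans (runMax_mono q (Nat.zero_le t))
    have h5 := hC t
    have h6 := neg_abs_le (x 0 i₀)
    have h7 := le_abs_self (x 0 i₀)
    rw [abs_le]
    constructor <;> linarith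
  set X := |x 0 i₀| + C with hX
  have hfx : ∀ t i, |f (x t i)| ≤ |f 0| + L' * (X + a) := by
    intro t i
    have h1 := hfa (x t i) 0
    rw [sub_zero] at h1
    have h2 := mul_le_mul_of_nonneg_left (hx t i) hL'.le
    have h3 : |f (x t i)| ≤ |f (x t i) - f 0| + |f 0| := by
      simpa using abs_add_le (f (x t i) - f 0) (f 0)
    linarith
  have hflow : ∀ t, |∑ j ∈ nbrs A i₀, A i₀ j * f (x t j)| ≤
      ∑ j ∈ nbrs A i₀, |A i₀ j| * (|f 0| + L' * (X + a)) := fun t =>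
    (Finset.abs_sum_le_sum_abs _ _).trans <| Finset.sum_le_sum fun j _ => by
      rw [abs_mul]
      exact mul_le_mul_of_nonneg_left (hfx t j) (abs_nonneg _)
  refine ⟨X + (X + ∑ j ∈ nbrs A i₀, |A i₀ j| * (|f 0| + L' * (X + a)) + W), ?_⟩
  rintro _ ⟨t, rfl⟩
  have h1 := abs_le.1 (hflow t)
  have h2 := abs_le.1 (hW t i₀)
  have h3 := abs_le.1 (hx (t + 1) i₀)
  have h4 := hcl.dynamics t i₀
  refine add_le_add (hx t i₀) (abs_le.2 ⟨?_, ?_⟩) <;> linarith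

/-! ### The adversary at and above the critical value -/

lemma exists_causal_sequence {T : Type*} [Inhabited T] (P : ℕ → (ℕ → T) → T → Prop)
    (hex : ∀ t g, ∃ v, P t g v)
    (hcausal : ∀ t g g' v, (∀ s < t, g s = g' s) → P t g v → P t g' v) :
    ∃ g : ℕ → T, ∀ t, P t g (g t) := by
  choose F hF using hex
  let g : ℕ → T := fun t => Nat.strongRec (motive := fun _ => T)
    (fun t ih => F t fun s => if h : s < t then ih s h else default) t
  have hg : ∀ t, g t = F t fun s => if s < t then g s else default := by
    intro t
    simp only [g]
    rw [Nat.strongRec_eq]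
    simp only [dite_eq_ite]
  refine ⟨g, fun t => ?_⟩
  rw [hg t]
  exact hcausal t _ _ _ (fun s hs => if_pos hs) (hF t _)

/-- A scalar controller that uses the states up to time `t` and the estimates and inputs before
time `t`. -/
def IsCausal (U : ℕ → (ℕ → ℝ) → (ℕ → ℝ) → (ℕ → ℝ) → ℝ) : Prop :=
  ∀ t x x' z z' u u', (∀ s ≤ t, x s = x' s) → (∀ s < t, z s = z' s) → (∀ s < t, u s = u' s) →
    U t x z u = U t x' z' u'

/-- What the adversary keeps track of at one time: the state, the value of `f` there, the input,
and the endpoint of the previous hull that is next to the state and the endpoint of the current hull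
opposite to it, each with its value of `f`. -/
structure AdversaryRecord where
  /-- state -/
  x : ℝ
  /-- value of `f` at the state -/
  z : ℝ
  /-- input -/
  u : ℝ
  /-- nearest endpoint of the previous hull -/
  xNear : ℝ
  /-- value of `f` at the nearest endpoint -/
  zNear : ℝ
  /-- opposite endpoint of the hull -/
  xFar : ℝ
  /-- value of `f` at the opposite endpoint -/
  zFar : ℝ

instance : Inhabited AdversaryRecord := ⟨⟨0, 0, 0, 0, 0, 0, 0⟩⟩

/-- The adversary's rule for the first record. -/
def IsFirstRecord (α : ℝ) (v : AdversaryRecord) : Prop :=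
  v.x = 0 ∧ α * v.z + v.u = 1 ∧ v.xNear = v.x ∧ v.zNear = v.z ∧ v.xFar = v.x ∧ v.zFar = v.z

/-- The adversary's rule for the record `v` that follows the record `w`. -/
def IsNextRecord (α L : ℝ) (w v : AdversaryRecord) : Prop :=
  v.x = α * w.z + w.u ∧
  ((|v.x - w.x| ≤ |v.x - w.xFar| ∧ v.xNear = w.x ∧ v.zNear = w.z ∧
      v.xFar = w.xFar ∧ v.zFar = w.zFar) ∨
    (|v.x - w.xFar| ≤ |v.x - w.x| ∧ v.xNear = w.xFar ∧ v.zNear = w.zFar ∧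
      v.xFar = w.x ∧ v.zFar = w.z)) ∧
  |v.z - v.zNear| ≤ L * |v.x - v.xNear| ∧
  α * L * |v.x - v.xNear| ≤ |α * v.z + v.u - (v.x + v.xFar) / 2|

lemma exists_value_far_from {α L d c m zNear : ℝ} (hα : 0 < α) (hL : 0 < L) (hd : 0 ≤ d) :
    ∃ z, |z - zNear| ≤ L * d ∧ α * L * d ≤ |α * z + c - m| := by
  have h0 : 0 ≤ L * d := by positivity
  have h1 : 0 ≤ α * L * d := by positivity
  rcases le_total 0 (α * zNear + c - m) with h | h
  · refine ⟨zNear + L * d, by rw [add_sub_cancel_left, abs_of_nonneg h0], ?_⟩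
    refine le_trans ?_ (le_abs_self _)
    linarith
  · refine ⟨zNear - L * d, by rw [sub_sub_cancel_left, abs_neg, abs_of_nonneg h0], ?_⟩
    refine le_trans ?_ (neg_le_abs _)
    linarith

lemma exists_adversary_records {α L : ℝ} (hα : 0 < α) (hL : 0 < L)
    {U : ℕ → (ℕ → ℝ) → (ℕ → ℝ) → (ℕ → ℝ) → ℝ} (hU : IsCausal U) :
    ∃ g : ℕ → AdversaryRecord,
      (∀ t, (g t).u = U t (fun s => (g s).x) (fun s => (g s).z) (fun s => (g s).u)) ∧
      IsFirstRecord α (g 0) ∧ ∀ t, IsNextRecord α L (g t) (g (t + 1)) := by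
  obtain ⟨g, hg⟩ := exists_causal_sequence
    (P := fun t g v =>
      v.u = U t (fun s => if s = t then v.x else (g s).x) (fun s => (g s).z) (fun s => (g s).u) ∧
      (t = 0 → IsFirstRecord α v) ∧ ∀ r, t = r + 1 → IsNextRecord α L (g r) v) (by
    intro t g
    cases t with
    | zero =>
      set u := U 0 (fun s => if s = 0 then 0 else (g s).x) (fun s => (g s).z) (fun s => (g s).u)
        with hu
      refine ⟨⟨0, (1 - u) / α, u, 0, (1 - u) / α, 0, (1 - u) / α⟩, hu,
        fun _ => ⟨rfl, ?_, rfl, rfl, rfl, rfl⟩, fun r hr => by omega⟩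
      change α * ((1 - u) / α) + u = 1
      field_simp
      ring
    | succ r =>
      set x := α * (g r).z + (g r).u with hx
      set u := U (r + 1) (fun s => if s = r + 1 then x else (g s).x) (fun s => (g s).z)
        (fun s => (g s).u) with hu
      rcases le_total |x - (g r).x| |x - (g r).xFar| with h | h
      · obtain ⟨z, h1, h2⟩ := exists_value_far_from (c := u) (m := (x + (g r).xFar) / 2)
          (zNear := (g r).z) hα hL (abs_nonneg (x - (g r).x))
        refine ⟨⟨x, z, u, (g r).x, (g r).z, (g r).xFar, (g r).zFar⟩, hu, fun h => by omega, ?_⟩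
        rintro _ ⟨rfl⟩
        exact ⟨hx, Or.inl ⟨h, rfl, rfl, rfl, rfl⟩, h1, h2⟩
      · obtain ⟨z, h1, h2⟩ := exists_value_far_from (c := u) (m := (x + (g r).x) / 2)
          (zNear := (g r).zFar) hα hL (abs_nonneg (x - (g r).xFar))
        refine ⟨⟨x, z, u, (g r).xFar, (g r).zFar, (g r).x, (g r).z⟩, hu, fun h => by omega, ?_⟩
        rintro _ ⟨rfl⟩
        exact ⟨hx, Or.inr ⟨h, rfl, rfl, rfl, rfl⟩, h1, h2⟩) (by
    rintro t g g' v hgg ⟨h1, h2, h3⟩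
    refine ⟨h1.trans (hU t _ _ _ _ _ _ (fun s hs => ?_) (fun s hs => ?_) (fun s hs => ?_)), h2,
      fun r hr => ?_⟩
    · rcases hs.eq_or_lt with rfl | hs
      · simp
      · simp [hs.ne, hgg s hs]
    · simp only [hgg s hs]
    · simp only [hgg s hs]
    · rw [← hgg r (by omega)]
      exact h3 r hr)
  refine ⟨g, fun t => ?_, (hg 0).2.1 rfl, fun t => (hg (t + 1)).2.2 t rfl⟩
  refine (hg t).1.trans (hU t _ _ _ _ _ _ (fun s hs => ?_) (fun _ _ => rfl) (fun _ _ => rfl))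
  split_ifs with h
  · rw [h]
  · rfl

/-- A point far away from the midpoint of `[r, p]`, on the side of `p`. -/
lemma outside_hull {p r y : ℝ} (hpr : 0 < |p - r|) (hfar : |p - r| / 2 < |y - (p + r) / 2|)
    (hside : |y - p| ≤ |y - r|) :
    |y - p| = |y - (p + r) / 2| - |p - r| / 2 ∧ |y - r| = |y - (p + r) / 2| + |p - r| / 2 ∧
      ∀ w ∈ Set.uIcc r p, |y - w| = |y - p| + |p - w| ∧ w ∈ Set.uIcc r y := by
  rcases lt_or_gt_of_ne (sub_ne_zero.1 (abs_pos.1 hpr)).symm with h | h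
  · rw [abs_of_pos (sub_pos.2 h)] at *
    have hy : p < y := by
      by_contra! hyp
      rw [abs_sub_comm y p, abs_of_nonneg (sub_nonneg.2 hyp)] at hside
      rcases abs_cases (y - r) with h1 | h1 <;> rcases abs_cases (y - (p + r) / 2) with h2 | h2 <;>
        linarith
    rw [abs_of_pos (sub_pos.2 hy), abs_of_pos (by linarith : 0 < y - r),
      abs_of_pos (by linarith : 0 < y - (p + r) / 2)]
    refine ⟨by ring, by ring, fun w hw => ?_⟩
    rw [Set.uIcc_of_le h.le] at hw
    rw [Set.uIcc_of_le (by linarith), abs_of_nonneg (by linarith [hw.2] : 0 ≤ y - w),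
      abs_of_nonneg (by linarith [hw.2] : 0 ≤ p - w)]
    exact ⟨by ring, hw.1, by linarith [hw.2]⟩
  · rw [abs_of_neg (sub_neg.2 h)] at *
    have hy : y < p := by
      by_contra! hyp
      rw [abs_of_nonneg (sub_nonneg.2 hyp)] at hside
      rcases abs_cases (y - r) with h1 | h1 <;> rcases abs_cases (y - (p + r) / 2) with h2 | h2 <;>
        linarith
    rw [abs_of_neg (sub_neg.2 hy), abs_of_neg (by linarith : y - r < 0),
      abs_of_neg (by linarith : y - (p + r) / 2 < 0)]
    refine ⟨by ring, by ring, fun w hw => ?_⟩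
    rw [Set.uIcc_of_ge h.le] at hw
    rw [Set.uIcc_of_ge (by linarith), abs_of_nonpos (by linarith [hw.1] : y - w ≤ 0),
      abs_of_nonpos (by linarith [hw.1] : p - w ≤ 0)]
    exact ⟨by ring, by linarith [hw.1], hw.2⟩

/-- The adversary's invariant at a positive time `t`. -/
structure AdversaryInvariant (L : ℝ) (g : ℕ → AdversaryRecord) (t : ℕ) : Prop where
  near_eq : ∃ m < t, (g t).xNear = (g m).x ∧ (g t).zNear = (g m).z
  far_eq : ∃ k < t, (g t).xFar = (g k).x ∧ (g t).zFar = (g k).z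
  mem_hull : ∀ s ≤ t, (g s).x ∈ Set.uIcc (g t).xFar (g t).x
  near_between : ∀ s < t,
    |(g t).x - (g s).x| = |(g t).x - (g t).xNear| + |(g t).xNear - (g s).x|
  lipschitz : ∀ r < t, ∀ s < t, |(g r).z - (g s).z| ≤ L * |(g r).x - (g s).x|
  extension_ge : (√2 - 1) * |(g t).x - (g t).xFar| ≤ |(g t).x - (g t).xNear|
  hull_ge : (3 / 2) ^ (t - 1) ≤ |(g t).x - (g t).xFar|

lemma AdversaryInvariant.lipschitz_le {α L : ℝ} {g : ℕ → AdversaryRecord} {t : ℕ}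
    (h : AdversaryInvariant L g (t + 1)) (hnext : IsNextRecord α L (g t) (g (t + 1))) :
    ∀ r ≤ t + 1, ∀ s ≤ t + 1, |(g r).z - (g s).z| ≤ L * |(g r).x - (g s).x| := by
  have hnew : ∀ s < t + 1, |(g (t + 1)).z - (g s).z| ≤ L * |(g (t + 1)).x - (g s).x| := by
    intro s hs
    obtain ⟨m, hm, h1, h2⟩ := h.near_eq
    rw [h.near_between s hs, mul_add]
    refine (abs_sub_le _ (g (t + 1)).zNear _).trans (add_le_add hnext.2.2.1 ?_)
    rw [h1, h2]
    exact h.lipschitz m hm s hs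
  intro r hr s hs
  rcases hr.eq_or_lt with rfl | hr <;> rcases hs.eq_or_lt with rfl | hs
  · simp
  · exact hnew s hs
  · rw [abs_sub_comm, abs_sub_comm (g r).x]
    exact hnew r hr
  · exact h.lipschitz r hr s hs

lemma adversaryInvariant_one {α L : ℝ} {g : ℕ → AdversaryRecord}
    (h0 : IsFirstRecord α (g 0)) (hnext : IsNextRecord α L (g 0) (g 1)) :
    AdversaryInvariant L g 1 := by
  obtain ⟨h1, h2, -, -, h5, h6⟩ := h0
  obtain ⟨k1, k2, -, -⟩ := hnext
  have hx : (g 1).x = 1 := k1.trans h2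
  have hr : (g 1).xNear = (g 0).x ∧ (g 1).zNear = (g 0).z ∧ (g 1).xFar = (g 0).x ∧
      (g 1).zFar = (g 0).z := by
    rcases k2 with ⟨-, a, b, c, d⟩ | ⟨-, a, b, c, d⟩
    · exact ⟨a, b, c.trans h5, d.trans h6⟩
    · exact ⟨a.trans h5, b.trans h6, c, d⟩
  obtain ⟨a, b, c, d⟩ := hr
  refine ⟨⟨0, one_pos, a, b⟩, ⟨0, one_pos, c, d⟩, fun s hs => ?_, fun s hs => ?_,
    fun r hr s hs => ?_, ?_, ?_⟩
  · rw [c]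
    interval_cases s
    · exact Set.left_mem_uIcc
    · exact Set.right_mem_uIcc
  · obtain rfl : s = 0 := by omega
    rw [a]
    simp
  · obtain rfl : s = 0 := by omega
    obtain rfl : r = 0 := by omega
    simp
  · rw [a, c, hx, h1]
    norm_num
  · rw [c, hx, h1]
    norm_num

lemma AdversaryInvariant.succ {α L : ℝ} {g : ℕ → AdversaryRecord} {t : ℕ}
    (hαL : 3 / 2 + √2 ≤ α * L) (h : AdversaryInvariant L g (t + 1))
    (hprev : IsNextRecord α L (g t) (g (t + 1)))
    (hnext : IsNextRecord α L (g (t + 1)) (g (t + 2))) : AdversaryInvariant L g (t + 2) := by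
  have hlip := h.lipschitz_le hprev
  obtain ⟨k, hk, hkx, hkz⟩ := h.far_eq
  obtain ⟨hx, hcase, -, -⟩ := hnext
  have hpos : 0 < |(g (t + 1)).x - (g (t + 1)).xFar| := lt_of_lt_of_le (by positivity) h.hull_ge
  have hs : √2 * √2 = 2 := Real.mul_self_sqrt (by norm_num)
  have hs0 : 1 ≤ √2 := Real.one_le_sqrt.2 (by norm_num)
  have hfar : (√2 + 1) / 2 * |(g (t + 1)).x - (g (t + 1)).xFar| ≤
      |(g (t + 2)).x - ((g (t + 1)).x + (g (t + 1)).xFar) / 2| := by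
    rw [hx]
    refine le_trans ?_ hprev.2.2.2
    calc (√2 + 1) / 2 * |(g (t + 1)).x - (g (t + 1)).xFar|
        = (3 / 2 + √2) * ((√2 - 1) * |(g (t + 1)).x - (g (t + 1)).xFar|) := by
          rw [← mul_assoc]
          congr 1
          linarith
      _ ≤ (3 / 2 + √2) * |(g (t + 1)).x - (g (t + 1)).xNear| :=
          mul_le_mul_of_nonneg_left h.extension_ge (by positivity)
      _ ≤ α * L * |(g (t + 1)).x - (g (t + 1)).xNear| :=
          mul_le_mul_of_nonneg_right hαL (abs_nonneg _)
  have hge := h.hull_ge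
  simp only [Nat.add_sub_cancel] at hge
  have hout : |(g (t + 1)).x - (g (t + 1)).xFar| / 2 <
      |(g (t + 2)).x - ((g (t + 1)).x + (g (t + 1)).xFar) / 2| := by
    nlinarith
  have hpow : ((3 : ℝ) / 2) ^ (t + 2 - 1) = (3 / 2) ^ t * (3 / 2) := pow_succ _ _
  have hext : ∀ E D : ℝ, (√2 + 1) / 2 * D ≤ E → (√2 - 1) * (E + D / 2) ≤ E - D / 2 := by
    intro E D hED
    have h1 := mul_le_mul_of_nonneg_left hED (by nlinarith : 0 ≤ 2 - √2)
    have h2 : (2 - √2) * ((√2 + 1) / 2 * D) = √2 / 2 * D := by linear_combination -(D / 2) * hs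
    linarith
  rcases hcase with ⟨hside, a, b, c, d⟩ | ⟨hside, a, b, c, d⟩
  · obtain ⟨h1, h2, h3⟩ := outside_hull hpos hout hside
    refine ⟨⟨t + 1, by omega, a, b⟩, ⟨k, by omega, c.trans hkx, d.trans hkz⟩, fun s hs => ?_,
      fun s hs => ?_, fun r hr s hs => hlip r (by omega) s (by omega), ?_, ?_⟩
    · rcases hs.eq_or_lt with rfl | hs
      · exact Set.right_mem_uIcc
      · rw [c]
        exact (h3 _ (h.mem_hull s (by omega))).2
    · rw [a]
      exact (h3 _ (h.mem_hull s (by omega))).1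
    · rw [a, c, h1, h2]
      exact hext _ _ hfar
    · rw [c, h2, hpow]
      nlinarith
  · rw [abs_sub_comm (g (t + 1)).x, add_comm (g (t + 1)).x] at hout hfar
    rw [abs_sub_comm (g (t + 1)).x] at hge hpos
    obtain ⟨h1, h2, h3⟩ := outside_hull hpos hout hside
    rw [Set.uIcc_comm] at h3
    refine ⟨⟨k, by omega, a.trans hkx, b.trans hkz⟩, ⟨t + 1, by omega, c, d⟩, fun s hs => ?_,
      fun s hs => ?_, fun r hr s hs => hlip r (by omega) s (by omega), ?_, ?_⟩
    · rcases hs.eq_or_lt with rfl | hs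
      · exact Set.right_mem_uIcc
      · rw [c]
        exact (h3 _ (h.mem_hull s (by omega))).2
    · rw [a]
      exact (h3 _ (h.mem_hull s (by omega))).1
    · rw [a, c, h1, h2]
      exact hext _ _ hfar
    · rw [c, h2, hpow]
      nlinarith

lemma exists_lipschitz_interpolation {x z : ℕ → ℝ} {L : ℝ} (hL : 0 ≤ L)
    (h : ∀ r s, |z r - z s| ≤ L * |x r - x s|) :
    ∃ f : ℝ → ℝ, (∀ a b, |f a - f b| ≤ L * |a - b|) ∧ ∀ t, f (x t) = z t := by
  have heq : ∀ t, z (Function.invFun x (x t)) = z t := by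
    intro t
    have h1 : x (Function.invFun x (x t)) = x t := Function.invFun_eq ⟨t, rfl⟩
    have h2 := h (Function.invFun x (x t)) t
    rw [h1, sub_self, abs_zero, mul_zero] at h2
    exact sub_eq_zero.1 (abs_nonpos_iff.1 h2)
  have hlip : LipschitzOnWith L.toNNReal (fun y => z (Function.invFun x y)) (Set.range x) := by
    refine LipschitzOnWith.of_dist_le_mul ?_
    rintro _ ⟨r, rfl⟩ _ ⟨s, rfl⟩
    simp only [heq, Real.dist_eq, Real.coe_toNNReal _ hL]
    exact h r s
  obtain ⟨f, hf, hfeq⟩ := hlip.extend_real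
  refine ⟨f, fun a b => ?_, fun t => ?_⟩
  · have := hf.dist_le_mul a b
    rwa [Real.dist_eq, Real.dist_eq, Real.coe_toNNReal _ hL] at this
  · rw [← hfeq ⟨t, rfl⟩]
    exact heq t

/-- At and above the critical value, every causal scalar controller has an unbounded run for some
`L`-Lipschitz function. -/
lemma exists_unbounded_run {α L : ℝ} (hα : 0 < α) (hL : 0 < L) (hαL : 3 / 2 + √2 ≤ α * L)
    {U : ℕ → (ℕ → ℝ) → (ℕ → ℝ) → (ℕ → ℝ) → ℝ} (hU : IsCausal U) :
    ∃ f : ℝ → ℝ, (∀ a b, |f a - f b| ≤ L * |a - b|) ∧ ∃ x z u : ℕ → ℝ,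
      (∀ t, z t = f (x t)) ∧ (∀ t, u t = U t x z u) ∧ (∀ t, x (t + 1) = α * f (x t) + u t) ∧
      ∀ C, ∃ t, C < |x t| := by
  obtain ⟨g, hu, hfirst, hnext⟩ := exists_adversary_records hα hL hU
  have hinv : ∀ t, AdversaryInvariant L g (t + 1) := by
    intro t
    induction t with
    | zero => exact adversaryInvariant_one hfirst (hnext 0)
    | succ t ih => exact ih.succ hαL (hnext t) (hnext (t + 1))
  obtain ⟨f, hf, hfx⟩ := exists_lipschitz_interpolation (x := fun t => (g t).x)
    (z := fun t => (g t).z) hL.le fun r s =>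
      (hinv (max r s)).lipschitz r (by omega) s (by omega)
  refine ⟨f, hf, fun t => (g t).x, fun t => (g t).z, fun t => (g t).u, fun t => (hfx t).symm, hu,
    fun t => ?_, fun C => ?_⟩
  · rw [hfx t]
    exact (hnext t).1
  · by_contra! hC
    obtain ⟨t, ht⟩ := pow_unbounded_of_one_lt (C + C) (by norm_num : (1 : ℝ) < 3 / 2)
    obtain ⟨k, -, hk, -⟩ := (hinv t).far_eq
    have h1 := (hinv t).hull_ge
    rw [Nat.add_sub_cancel, hk] at h1
    have h2 := abs_sub (g (t + 1)).x (g k).x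
    have h3 := hC (t + 1)
    have h4 := hC k
    linarith

lemma infNorm_scalar {α : ℝ} (hα : 0 < α) :
    infNorm (fun _ _ => α : Matrix (Fin 1) (Fin 1) ℝ) = α := by
  simp [infNorm, nbrs, hα.ne', abs_of_pos hα]

lemma isCausal_scalar (h : FeedbackLaw) (A : Matrix (Fin 1) (Fin 1) ℝ) :
    IsCausal fun t x z u => h 0 t
      (localInfo A (fun s _ => x s) (fun s _ => z s) (fun s _ => u s) (fun _ => 0) (fun _ => 0)
        0 t) := by
  intro t x x' z z' u u' hx hz hu
  simp only
  congr 1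
  have aux : ∀ (P : Prop) [Decidable P] (a b : ℝ), (P → a = b) →
      (if P then a else 0) = if P then b else 0 := by
    intro P _ a b hab
    split_ifs with hP
    · exact hab hP
    · rfl
  simp only [localInfo, LocalInfo.mk.injEq, true_and]
  refine ⟨?_, ?_, ?_, ?_, ?_, ?_, ?_⟩
  · funext j s
    split_ifs with h1 h2
    exacts [hx s h2.2, rfl, rfl]
  · funext j s
    split_ifs with h1 h2
    exacts [hz s h2.2, rfl, rfl]
  · funext j s
    split_ifs with h1 h2
    exacts [hu s h2.2, rfl, rfl]
  · exact funext fun s => aux _ _ _ (hx s)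
  · exact funext fun s => aux _ _ _ (hx s)
  · exact funext fun s => aux _ _ _ (hz s)
  · exact funext fun s => aux _ _ _ (hz s)

theorem exists_not_stabilizes {α L : ℝ} (hα : 0 < α) (hL : 0 < L) (hαL : 3 / 2 + √2 ≤ α * L)
    (h : FeedbackLaw) :
    ∃ f ∈ FClass L, ¬ Stabilizes h (fun _ _ => α : Matrix (Fin 1) (Fin 1) ℝ) f := by
  set A : Matrix (Fin 1) (Fin 1) ℝ := fun _ _ => α with hA
  obtain ⟨f, hf, x, z, u, hz, hu, hx, hunb⟩ :=
    exists_unbounded_run hα hL hαL (isCausal_scalar h A)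
  refine ⟨f, mem_FClass_of_lipschitz hL.le hf, fun hst => ?_⟩
  obtain ⟨C, hC⟩ := hst (fun s _ => x s) (fun s _ => z s) (fun s _ => u s) (fun _ _ => 0)
    (fun _ => 0) (fun _ => 0)
    { dynamics := fun t i => by
        simp [hx t, nbrs, hA, hα.ne']
      control := fun t i => by
        obtain rfl : i = 0 := Subsingleton.elim _ _
        exact hu t
      disturbance_bounded := ⟨1, one_pos, fun t i => by simp⟩
      estimate_bounded := ⟨0, fun t i => by simp [hz t]⟩
      isMax := fun t i => le_rfl
      isMin := fun t i => le_rfl } 0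
  obtain ⟨t, ht⟩ := hunb C
  have h1 : |x t| + |u t| ≤ C := hC ⟨t, rfl⟩
  linarith [abs_nonneg (u t)]

end NetworkFeedback

end

theorem theorem5 :
    (∃ h : NetworkFeedback.FeedbackLaw,
      ∀ L : ℝ, 0 < L → ∀ n : ℕ, 1 ≤ n → ∀ A : Matrix (Fin n) (Fin n) ℝ,
        L * NetworkFeedback.infNorm A < 3 / 2 + √2 →
          ∀ f ∈ NetworkFeedback.FClass L, NetworkFeedback.Stabilizes h A f) ∧
    (∀ L α : ℝ, 0 < L → 0 < α →
      ((∃ h : ℕ → NetworkFeedback.FeedbackLaw,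
          ∀ n : ℕ, 1 ≤ n → ∀ A : Matrix (Fin n) (Fin n) ℝ, NetworkFeedback.infNorm A = α →
            ∀ f ∈ NetworkFeedback.FClass L, NetworkFeedback.Stabilizes (h n) A f) ↔
        L < (3 / 2 + √2) / α)) := by
  refine ⟨⟨NetworkFeedback.nearestExtremeLaw, fun L hL n _ A hLA f hf =>
    NetworkFeedback.stabilizes_nearestExtremeLaw hL A hLA hf⟩, fun L α hL hα => ⟨?_, fun hlt => ?_⟩⟩
  · rintro ⟨h, hst⟩
    by_contra! hle
    rw [div_le_iff₀ hα, mul_comm] at hle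
    obtain ⟨f, hf, hnot⟩ := NetworkFeedback.exists_not_stabilizes hα hL hle (h 1)
    exact hnot (hst 1 le_rfl _ (NetworkFeedback.infNorm_scalar hα) f hf)
  · refine ⟨fun _ => NetworkFeedback.nearestExtremeLaw, fun n _ A hA f hf =>
      NetworkFeedback.stabilizes_nearestExtremeLaw hL A ?_ hf⟩
    rw [hA]
    exact (lt_div_iff₀ hα).1 hlt
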